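/- Conventions. For $A\subseteq\mathbb Z$ let $$d^*(A)=\lim_{M\to\infty}\,\sup_{N\in\mathbb Z}\frac{|A\cap[N,N+M)|}{M}$$ be the upper Banach density. A set $S\subseteq\mathbb Z$ is \emph{syndetic} if $S+F=\mathbb Z$ for some finite $F\subseteq\mathbb Z$, \emph{thick} if it contains intervals of every finite length, and \emph{piecewise syndetic} if it is the intersection of a syndetic set with a thick set. For a sequence $\nu=(\nu_j)_{j\in\mathbb N}$ of probability measures on $\mathbb Z$ put $d_\nu(A)=\limsup_{j\to\infty}\nu_j(A)$; the sequence is an \emph{equidistributed averaging sequence} if $\lim_{j\to\infty}\int e^{in\theta}\,d\nu_j(n)=0$ for every $\theta\in(0,2\pi)$. A \emph{Kronecker system} $(Z,\mathscr Z,m,R_\alpha)$ consists of a compact Hausdorff (not necessarily metrizable) abelian group $Z$, its Borel $\sigma$-algebra $\mathscr Z$, its normalized (regular) Haar measure $m$, and the rotation $R_\alpha(z)=z+\alpha$ by an element $\alpha\in Z$ for which $\{n\alpha:n\in\mathbb Z\}$ is dense in $Z$. Proposition. Let $(Z,\mathscr Z,m,R_\alpha)$ be a Kronecker system and let $A\subseteq\mathbb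 Z$ be such that the closure $\overline{\{n\alpha:n\in A\}}$ in $Z$ has Haar measure $0$. Then: (1) For every $\varepsilon>0$ there exists $B\subseteq\mathbb Z$ with $d^*(B)>1-\varepsilon$ such that $A+B=\{a+b:a\in A,\ b\in B\}$ is not piecewise syndetic. (2) If, for each $i\in\mathbb N$, $\nu^{(i)}=(\nu^{(i)}_j)_{j\in\mathbb N}$ is an equidistributed averaging sequence, then for every $\varepsilon>0$ there exists $B\subseteq\mathbb Z$ such that $d_{\nu^{(i)}}(B)>1-\varepsilon$ for all $i\in\mathbb N$ and $A+B$ is not piecewise syndetic. -/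

import Mathlib

open MeasureTheory Filter Topology
open scoped Pointwise

/-- `S ⊆ ℤ` is syndetic: finitely many translates of `S` cover `ℤ`. -/
def IsSyndetic (S : Set ℤ) : Prop :=
  ∃ F : Set ℤ, F.Finite ∧ S + F = Set.univ

/-- `S ⊆ ℤ` is thick: it contains intervals of every finite length. -/
def IsThick (S : Set ℤ) : Prop :=
  ∀ L : ℕ, ∃ N : ℤ, Set.Ico N (N + L) ⊆ S

/-- `S ⊆ ℤ` is piecewise syndetic: it is the intersection of a syndetic set with a thick set. -/
def IsPiecewiseSyndetic (S : Set ℤ) : Prop :=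
  ∃ T U : Set ℤ, IsSyndetic T ∧ IsThick U ∧ S = T ∩ U

/-- The largest number of elements of `A` in an interval of `M` consecutive integers. -/
noncomputable def maxWindowCount (A : Set ℤ) (M : ℕ) : ℕ :=
  ⨆ N : ℤ, (A ∩ Set.Ico N (N + M)).ncard

/-- The upper Banach density `lim_{M → ∞} sup_N |A ∩ [N, N + M)| / M`. The limit always exists,
see `tendsto_upperBanachDensity`. -/
noncomputable def upperBanachDensity (A : Set ℤ) : ℝ :=
  limsup (fun M : ℕ => (maxWindowCount A M : ℝ) / M) atTop

lemma ncard_window_le (A : Set ℤ) (N : ℤ) (M : ℕ) : (A ∩ Set.Ico N (N + M)).ncard ≤ M := by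
  refine (Set.ncard_le_ncard Set.inter_subset_right (Set.finite_Ico _ _)).trans ?_
  rw [← Finset.coe_Ico, Set.ncard_coe_finset]
  simp

lemma ncard_window_le_max (A : Set ℤ) (N : ℤ) (M : ℕ) :
    (A ∩ Set.Ico N (N + M)).ncard ≤ maxWindowCount A M :=
  le_ciSup (f := fun N : ℤ => (A ∩ Set.Ico N (N + M)).ncard)
    ⟨M, by rintro _ ⟨N, rfl⟩; exact ncard_window_le A N M⟩ N

lemma maxWindowCount_le (A : Set ℤ) (M : ℕ) : maxWindowCount A M ≤ M :=
  ciSup_le fun N => ncard_window_le A N M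

lemma subadditive_maxWindowCount (A : Set ℤ) :
    Subadditive (fun M : ℕ => (maxWindowCount A M : ℝ)) := by
  intro m n
  rw [← Nat.cast_add, Nat.cast_le]
  refine ciSup_le fun N => ?_
  have h : A ∩ Set.Ico N (N + ((m + n : ℕ) : ℤ)) ⊆
      (A ∩ Set.Ico N (N + m)) ∪ (A ∩ Set.Ico (N + m) (N + m + n)) := by
    rintro x ⟨hx, h1, h2⟩
    push_cast at h2
    by_cases h3 : x < N + m
    · exact Or.inl ⟨hx, h1, h3⟩
    · exact Or.inr ⟨hx, not_lt.mp h3, by linarith⟩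
  refine (Set.ncard_le_ncard h (((Set.finite_Ico _ _).inter_of_right _).union
    ((Set.finite_Ico _ _).inter_of_right _))).trans ((Set.ncard_union_le _ _).trans ?_)
  exact add_le_add (ncard_window_le_max A N m) (ncard_window_le_max A (N + m) n)

/-- The limit in the definition of the upper Banach density exists. -/
theorem tendsto_upperBanachDensity (A : Set ℤ) :
    Tendsto (fun M : ℕ => (maxWindowCount A M : ℝ) / M) atTop (𝓝 (upperBanachDensity A)) := by
  have h := (subadditive_maxWindowCount A).tendsto_lim
    ⟨0, by rintro _ ⟨n, rfl⟩; positivity⟩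
  have h2 : upperBanachDensity A = (subadditive_maxWindowCount A).lim := h.limsup_eq
  rw [h2]
  exact h

/-- The upper density `limsup_j ν_j(A)` of `A ⊆ ℤ` with respect to a sequence `ν` of probability
measures on `ℤ`. -/
noncomputable def upperDensityAlong (ν : ℕ → ProbabilityMeasure ℤ) (A : Set ℤ) : ℝ :=
  limsup (fun j => (ν j : Measure ℤ).real A) atTop

/-- A sequence `ν` of probability measures on `ℤ` is an equidistributed averaging sequence if
`∫ e^{inθ} dν_j(n) → 0` for every `θ ∈ (0, 2π)`. -/
def IsEquidistributedAveraging (ν : ℕ → ProbabilityMeasure ℤ) : Prop :=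
  ∀ θ ∈ Set.Ioo (0 : ℝ) (2 * Real.pi),
    Tendsto (fun j => ∫ n : ℤ, Complex.exp (Complex.I * n * θ) ∂(ν j : Measure ℤ)) atTop (𝓝 0)

/-- `(Z, 𝓑(Z), m, R_α)`, where `R_α z = z + α`, is a Kronecker system: `Z` is a compact (Hausdorff,
not necessarily metrizable) abelian group with its Borel σ-algebra, `m` is the Haar probability
measure of `Z` (a regular Borel measure), and `{nα : n ∈ ℤ}` is dense in `Z`. -/
structure IsKroneckerSystem {Z : Type*} [AddCommGroup Z] [TopologicalSpace Z]
    [IsTopologicalAddGroup Z] [CompactSpace Z] [T2Space Z] [MeasurableSpace Z] [BorelSpace Z]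
    (m : Measure Z) (α : Z) : Prop where
  isAddHaarMeasure : m.IsAddHaarMeasure
  regular : m.Regular
  isProbabilityMeasure : IsProbabilityMeasure m
  dense : Dense (Set.range fun n : ℤ => n • α)

/-!
Let `K` be the closure of `{nα : n ∈ A}`, a compact null set. The set `B` is a set of return times
`{n : z + nα ∈ C}` for a closed set `C ⊆ Z` and a suitable point `z`, so that `A + B` is contained
in the set of return times of `z` to the closed set `K + C`.

* Choice of `C`. Each `nα - K` is a null set. Removing from `Z` open neighbourhoods of these sets of
  total measure less than `ε` leaves a closed set `C` of measure greater than `1 - ε` such that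
  `K + C` contains no `nα`; thus `K + C` is closed with dense complement
  (`IsKroneckerSystem.exists_isClosed_dense_compl_add`). Since the rotation is minimal, return times
  to such a set are never piecewise syndetic (`IsKroneckerSystem.not_isPiecewiseSyndetic`).
* Choice of `z`. Along an equidistributed averaging sequence `ν`, the averages
  `ν_j {n : z + nα ∈ C}` converge to `m(C)` in `L²(m)` as functions of `z`, hence for almost every
  `z` along a subsequence (`IsKroneckerSystem.exists_seq_tendsto_ae`). Countably many sequences
  exclude only a null set of `z`. The upper Banach density is handled through the uniform measures
  on `{0, …, N}`, which are equidistributed.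

The `L²` convergence is a mean ergodic theorem for a unitary operator `U`
(`IsEquidistributedAveraging.tendsto_integral_zpow_apply`). With the spectral measure `σ` of a
vector `x`, obtained from the continuous functional calculus and the Riesz–Markov–Kakutani theorem, one has
`‖∫ Uⁿ x dν_j‖² = ∫ |∫ zⁿ dν_j(n)|² dσ(z) → σ({1})` by dominated convergence. This limit is the same
for all equidistributed averaging sequences, and von Neumann's theorem for Cesàro averages shows
that it vanishes if `x` is orthogonal to the fixed vectors of `U`. For the rotation, the fixed
vectors are the constants by ergodicity (`IsKroneckerSystem.ergodic`).
-/

/-! ### Piecewise syndetic sets -/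

lemma IsPiecewiseSyndetic.exists_finite_isThick_add {S : Set ℤ} (hS : IsPiecewiseSyndetic S) :
    ∃ F : Set ℤ, F.Finite ∧ IsThick (S + F) := by
  obtain ⟨T, U, ⟨F, hF, hTF⟩, hU, rfl⟩ := hS
  refine ⟨F, hF, fun L => ?_⟩
  obtain ⟨b, hb⟩ : ∃ b : ℕ, ∀ f ∈ F, |f| ≤ b := by
    obtain ⟨b, hb⟩ := (hF.image abs).bddAbove
    exact ⟨b.toNat, fun f hf => (hb ⟨f, hf, rfl⟩).trans (Int.self_le_toNat b)⟩
  -- An interval of `U` of length `L + 2b`, shrunk by `b` on both sides, is covered.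
  obtain ⟨N, hN⟩ := hU (L + 2 * b)
  refine ⟨N + b, fun x hx => ?_⟩
  obtain ⟨t, ht, f, hf, rfl⟩ : x ∈ T + F := hTF ▸ Set.mem_univ x
  have := abs_le.mp (hb f hf)
  simp only [Set.mem_Ico] at hx
  refine Set.add_mem_add ⟨ht, hN ?_⟩ hf
  simp only [Set.mem_Ico]
  push_cast
  constructor <;> linarith

/-! ### Unitary averages along equidistributed sequences -/

section Spectral

variable {H : Type*} [NormedAddCommGroup H] [InnerProductSpace ℂ H] [CompleteSpace H]

open scoped CompactlySupported in
/-- The spectral measure of a vector `x` for a normal operator `a`: the functional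
`g ↦ ⟪x, g(a) x⟫` on continuous functions on the spectrum is positive, since `g = (√g)²` for
`g ≥ 0`, so it is represented by a measure. -/
theorem exists_spectralMeasure (a : H →L[ℂ] H) (ha : IsStarNormal a) (x : H) :
    ∃ σ : Measure (spectrum ℂ a), IsFiniteMeasure σ ∧
      ∀ φ : C(spectrum ℂ a, ℂ), ‖cfcHom ha φ x‖ ^ 2 = ∫ z, ‖φ z‖ ^ 2 ∂σ := by
  have key (φ : C(spectrum ℂ a, ℂ)) :
      (inner ℂ x (cfcHom ha (star φ * φ) x)).re = ‖cfcHom ha φ x‖ ^ 2 := by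
    rw [map_mul, map_star, ContinuousLinearMap.star_eq_adjoint, mul_apply_eq_comp,
      ContinuousLinearMap.adjoint_inner_right, inner_self_eq_norm_sq_to_K]
    norm_cast
  let toC (g : C_c(spectrum ℂ a, ℝ)) : C(spectrum ℂ a, ℂ) := ⟨fun z => (g z : ℂ), by fun_prop⟩
  let Λ₀ : C_c(spectrum ℂ a, ℝ) →ₗ[ℝ] ℝ :=
    { toFun := fun g => (inner ℂ x (cfcHom ha (toC g) x)).re
      map_add' := fun g h => by
        have : toC (g + h) = toC g + toC h := by ext z; simp [toC]
        simp [this]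
      map_smul' := fun c g => by
        have : toC (c • g) = (c : ℂ) • toC g := by ext z; simp [toC]
        rw [this, map_smul, _root_.smul_apply, inner_smul_right]
        simp }
  let Λ : C_c(spectrum ℂ a, ℝ) →ₚ[ℝ] ℝ := PositiveLinearMap.mk₀ Λ₀ fun g hg => by
    let ψ : C(spectrum ℂ a, ℂ) := ⟨fun z => (Real.sqrt (g z) : ℂ), by fun_prop⟩
    have : toC g = star ψ * ψ := by
      ext z
      have : 0 ≤ g z := hg z
      simp only [toC, ψ, ContinuousMap.coe_mk, ContinuousMap.mul_apply, ContinuousMap.star_apply,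
        RCLike.star_def, Complex.conj_ofReal]
      rw [← Complex.ofReal_mul, Real.mul_self_sqrt this]
    change 0 ≤ (inner ℂ x (cfcHom ha (toC g) x)).re
    rw [this, key]
    positivity
  have hfin : IsFiniteMeasureOnCompacts (RealRMK.rieszMeasure Λ) := inferInstance
  refine ⟨RealRMK.rieszMeasure Λ, ⟨isCompact_univ.measure_lt_top⟩, fun φ => ?_⟩
  let g : C_c(spectrum ℂ a, ℝ) :=
    CompactlySupportedContinuousMap.continuousMapEquiv ⟨fun z => ‖φ z‖ ^ 2, by fun_prop⟩
  have h1 : ∫ z, g z ∂(RealRMK.rieszMeasure Λ) = Λ g := RealRMK.integral_rieszMeasure Λ g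
  have h2 : toC g = star φ * φ := by
    ext z
    change ((‖φ z‖ ^ 2 : ℝ) : ℂ) = star (φ z) * φ z
    rw [RCLike.star_def, Complex.conj_mul']
    norm_cast
  have h3 : Λ g = (inner ℂ x (cfcHom ha (toC g) x)).re := rfl
  rw [← key, ← h2, ← h3, ← h1]
  rfl

lemma Unitary.isStarNormal_coe (U : unitary (H →L[ℂ] H)) : IsStarNormal (U : H →L[ℂ] H) :=
  ⟨by rw [Commute, SemiconjBy, Unitary.star_mul_self_of_mem U.2, Unitary.mul_star_self_of_mem U.2]⟩

lemma ne_zero_of_mem_spectrum_unitary (U : unitary (H →L[ℂ] H))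
    (z : spectrum ℂ (U : H →L[ℂ] H)) : (z : ℂ) ≠ 0 := fun h => by
  have := spectrum.norm_eq_one_of_unitary U.2 z.2
  simp [h] at this

/-- The function `z ↦ z ^ n` on the spectrum of a unitary operator. -/
noncomputable def spectrumZPow (U : unitary (H →L[ℂ] H)) (n : ℤ) :
    C(spectrum ℂ (U : H →L[ℂ] H), ℂ) :=
  ⟨fun z => (z : ℂ) ^ n, continuous_subtype_val.zpow₀ n fun z =>
    Or.inl (ne_zero_of_mem_spectrum_unitary U z)⟩

lemma cfcHom_spectrumZPow (U : unitary (H →L[ℂ] H)) (n : ℤ) :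
    cfcHom (Unitary.isStarNormal_coe U) (spectrumZPow U n) =
      ((U ^ n : unitary (H →L[ℂ] H)) : H →L[ℂ] H) := by
  have h1 : cfcHom (Unitary.isStarNormal_coe U) (spectrumZPow U 1) = U := by
    have : spectrumZPow U 1 = (ContinuousMap.id ℂ).restrict (spectrum ℂ (U : H →L[ℂ] H)) := by
      ext z
      simp [spectrumZPow]
    rw [this]
    exact cfcHom_id _
  have hmul (k l : ℤ) : spectrumZPow U (k + l) = spectrumZPow U k * spectrumZPow U l := by
    ext z
    simp [spectrumZPow, zpow_add₀ (ne_zero_of_mem_spectrum_unitary U z)]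
  have h0 : cfcHom (Unitary.isStarNormal_coe U) (spectrumZPow U 0) = 1 := by
    have : spectrumZPow U 0 = 1 := by
      ext z
      simp [spectrumZPow]
    rw [this, map_one]
  induction n with
  | zero => simpa using h0
  | succ k ih => rw [hmul, map_mul, ih, h1, zpow_add_one]; rfl
  | pred k ih =>
    have := hmul (-k - 1) 1
    rw [sub_add_cancel] at this
    rw [this, map_mul, h1] at ih
    rw [zpow_sub_one, Submonoid.coe_mul, ← ih, mul_assoc, ← Submonoid.coe_mul, mul_inv_cancel]
    simp

lemma norm_spectrumZPow_le (U : unitary (H →L[ℂ] H)) (n : ℤ) : ‖spectrumZPow U n‖ ≤ 1 := by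
  refine (ContinuousMap.norm_le _ zero_le_one).mpr fun z => ?_
  simp [spectrumZPow, spectrum.norm_eq_one_of_unitary U.2 z.2]

lemma integrable_of_norm_le {E : Type*} [NormedAddCommGroup E] (μ : Measure ℤ) [IsFiniteMeasure μ]
    {f : ℤ → E} {C : ℝ} (h : ∀ n, ‖f n‖ ≤ C) : Integrable f μ :=
  Integrable.of_bound StronglyMeasurable.of_discrete.aestronglyMeasurable C (ae_of_all _ h)

/-- Along an equidistributed averaging sequence, `∫ z ^ n dν_j(n)` tends to the indicator function
of `{1}` on the unit circle. -/
lemma IsEquidistributedAveraging.tendsto_integral_zpow {ν : ℕ → ProbabilityMeasure ℤ}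
    (hν : IsEquidistributedAveraging ν) {z : ℂ} (hz : ‖z‖ = 1) :
    Tendsto (fun j => ∫ n : ℤ, z ^ n ∂(ν j : Measure ℤ)) atTop (𝓝 (if z = 1 then 1 else 0)) := by
  split_ifs with h
  · simp [h]
  · have key : Complex.exp (Complex.I * (toIocMod Real.two_pi_pos 0 z.arg : ℝ)) = z := by
      conv_rhs => rw [← Complex.norm_mul_exp_arg_mul_I z, hz]
      rw [← self_sub_toIocDiv_zsmul, Complex.ofReal_one, one_mul,
        Complex.exp_eq_exp_iff_exists_int]
      exact ⟨-toIocDiv Real.two_pi_pos 0 z.arg, by push_cast [zsmul_eq_mul]; ring⟩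
    set θ := toIocMod Real.two_pi_pos 0 z.arg with hθ
    have hmem : θ ∈ Set.Ioc 0 (0 + 2 * Real.pi) := toIocMod_mem_Ioc _ _ _
    rw [zero_add] at hmem
    have hne : θ ≠ 2 * Real.pi := fun h' => h <| by
      rw [← key, h']
      push_cast
      rw [mul_comm]
      exact Complex.exp_two_pi_mul_I
    refine (hν θ ⟨hmem.1, lt_of_le_of_ne hmem.2 hne⟩).congr fun j => ?_
    refine integral_congr_ae (ae_of_all _ fun n => ?_)
    simp only
    rw [← key, ← Complex.exp_int_mul]
    congr 1
    ring

/-- The norm of the averages of `U ^ n x` along an equidistributed averaging sequence converges to a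
limit which is the same for all such sequences. -/
theorem exists_tendsto_norm_sq_integral_zpow (U : unitary (H →L[ℂ] H)) (x : H) :
    ∃ c : ℝ, ∀ ν : ℕ → ProbabilityMeasure ℤ, IsEquidistributedAveraging ν →
      Tendsto (fun j => ‖∫ n : ℤ, ((U ^ n : unitary (H →L[ℂ] H)) : H →L[ℂ] H) x
        ∂(ν j : Measure ℤ)‖ ^ 2) atTop (𝓝 c) := by
  obtain ⟨σ, hσ, hσx⟩ := exists_spectralMeasure (U : H →L[ℂ] H) (Unitary.isStarNormal_coe U) x
  refine ⟨∫ z : spectrum ℂ (U : H →L[ℂ] H), ‖(if (z : ℂ) = 1 then (1 : ℂ) else 0)‖ ^ 2 ∂σ,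
    fun ν hν => ?_⟩
  have hint (j : ℕ) : Integrable (spectrumZPow U) (ν j : Measure ℤ) :=
    integrable_of_norm_le _ (norm_spectrumZPow_le U)
  have h1 (j : ℕ) :
      ‖∫ n : ℤ, ((U ^ n : unitary (H →L[ℂ] H)) : H →L[ℂ] H) x ∂(ν j : Measure ℤ)‖ ^ 2 =
        ∫ z : spectrum ℂ (U : H →L[ℂ] H), ‖∫ n : ℤ, (z : ℂ) ^ n ∂(ν j : Measure ℤ)‖ ^ 2 ∂σ := by
    have h2 : ∫ n : ℤ, ((U ^ n : unitary (H →L[ℂ] H)) : H →L[ℂ] H) x ∂(ν j : Measure ℤ) =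
        cfcHom (Unitary.isStarNormal_coe U) (∫ n : ℤ, spectrumZPow U n ∂(ν j : Measure ℤ)) x := by
      have := ((ContinuousLinearMap.apply ℂ H x).comp
        (cfcL (Unitary.isStarNormal_coe U))).integral_comp_comm (hint j)
      simp only [ContinuousLinearMap.comp_apply, ContinuousLinearMap.apply_apply,
        cfcL_apply, cfcHom_spectrumZPow] at this
      exact this
    rw [h2, hσx]
    refine integral_congr_ae (ae_of_all _ fun z => ?_)
    have := (ContinuousMap.evalCLM ℂ z).integral_comp_comm (hint j)
    simp only [ContinuousMap.evalCLM_apply] at this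
    simp only [← this]
    rfl
  simp_rw [h1]
  refine tendsto_integral_of_dominated_convergence (fun _ => 1) (fun j => ?_)
    (integrable_const _) (fun j => ae_of_all _ fun z => ?_) (ae_of_all _ fun z => ?_)
  · have : Continuous fun z : spectrum ℂ (U : H →L[ℂ] H) =>
        ‖(∫ n : ℤ, spectrumZPow U n ∂(ν j : Measure ℤ)) z‖ ^ 2 := by fun_prop
    convert this.aestronglyMeasurable using 3 with z
    have := (ContinuousMap.evalCLM ℂ z).integral_comp_comm (hint j)
    simp only [ContinuousMap.evalCLM_apply] at this
    rw [← this]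
    rfl
  · have : ‖∫ n : ℤ, (z : ℂ) ^ n ∂(ν j : Measure ℤ)‖ ≤ 1 := by
      have := norm_integral_le_of_norm_le_const (μ := (ν j : Measure ℤ)) (C := 1)
        (f := fun n : ℤ => (z : ℂ) ^ n) (ae_of_all _ fun n => by
          simp [spectrum.norm_eq_one_of_unitary U.2 z.2])
      simpa using this
    rw [Real.norm_of_nonneg (by positivity)]
    exact pow_le_one₀ (norm_nonneg _) this
  · exact ((hν.tendsto_integral_zpow
      (spectrum.norm_eq_one_of_unitary U.2 z.2)).norm).pow 2

end Spectral

/-! ### Cesàro averages -/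

/-- The uniform probability measure on `{0, …, N}`. -/
noncomputable def cesaroMeasure (N : ℕ) : ProbabilityMeasure ℤ :=
  ⟨((N + 1 : ℕ) : ENNReal)⁻¹ • ∑ n ∈ Finset.range (N + 1), Measure.dirac (n : ℤ), ⟨by
    simp [Measure.finsetSum_apply]
    exact_mod_cast ENNReal.inv_mul_cancel (a := ((N + 1 : ℕ) : ENNReal)) (by simp) (by finiteness)⟩⟩

lemma integral_cesaroMeasure {E : Type*} [NormedAddCommGroup E] [NormedSpace ℝ E] [CompleteSpace E]
    (f : ℤ → E) (N : ℕ) :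
    ∫ n, f n ∂(cesaroMeasure N : Measure ℤ) =
      ((N + 1 : ℕ) : ℝ)⁻¹ • ∑ n ∈ Finset.range (N + 1), f n := by
  change ∫ n, f n ∂(((N + 1 : ℕ) : ENNReal)⁻¹ • ∑ n ∈ Finset.range (N + 1),
    Measure.dirac (n : ℤ)) = _
  rw [integral_smul_measure, integral_finsetSum_measure fun n _ => by
    exact integrable_dirac (by finiteness)]
  simp only [integral_dirac, ENNReal.toReal_inv, ENNReal.toReal_natCast]

lemma cesaroMeasure_real_apply (B : Set ℤ) (N : ℕ) :
    (cesaroMeasure N : Measure ℤ).real B =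
      ((B ∩ Set.Ico (0 : ℤ) (0 + (N + 1 : ℕ))).ncard : ℝ) / (N + 1 : ℕ) := by
  classical
  have h1 := integral_cesaroMeasure (B.indicator (1 : ℤ → ℝ)) N
  rw [integral_indicator_one (MeasurableSet.of_discrete)] at h1
  rw [h1, smul_eq_mul, div_eq_inv_mul]
  congr 1
  have h2 : B ∩ Set.Ico (0 : ℤ) (0 + (N + 1 : ℕ)) =
      (((Finset.range (N + 1)).filter fun n : ℕ => (n : ℤ) ∈ B).map Nat.castEmbedding :
        Finset ℤ) := by
    ext x
    simp only [Set.mem_inter_iff, Set.mem_Ico, Finset.coe_map, Set.mem_image, Finset.mem_coe,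
      Finset.mem_filter, Finset.mem_range, Nat.castEmbedding_apply]
    constructor
    · rintro ⟨hx, h0, h1⟩
      lift x to ℕ using h0
      exact ⟨x, ⟨by omega, hx⟩, rfl⟩
    · rintro ⟨n, ⟨h, hn⟩, rfl⟩
      exact ⟨hn, by omega, by omega⟩
  rw [h2, Set.ncard_coe_finset, Finset.card_map]
  simp [Set.indicator_apply]

lemma isEquidistributedAveraging_cesaroMeasure : IsEquidistributedAveraging cesaroMeasure := by
  intro θ hθ
  have hne : Complex.exp (Complex.I * θ) ≠ 1 := by
    intro h
    obtain ⟨n, hn⟩ := Complex.exp_eq_one_iff.mp h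
    have h2 : (θ : ℂ) = ((n * (2 * Real.pi) : ℝ) : ℂ) := by
      have := mul_left_cancel₀ Complex.I_ne_zero (hn.trans (by ring :
        (n : ℂ) * (2 * Real.pi * Complex.I) = Complex.I * (n * (2 * Real.pi))))
      rw [this]; push_cast; rfl
    have h3 : θ = n * (2 * Real.pi) := Complex.ofReal_injective h2
    have hpi := Real.two_pi_pos
    have h4 : (0 : ℝ) < n := by
      by_contra! h5
      nlinarith [hθ.1]
    have h5 : (n : ℝ) < 1 := by
      by_contra! h5
      nlinarith [hθ.2]
    have : 0 < n := by exact_mod_cast h4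
    have : n < 1 := by exact_mod_cast h5
    omega
  set z := Complex.exp (Complex.I * θ) with hz
  have hz1 : ‖z‖ = 1 := by rw [hz, mul_comm]; exact Complex.norm_exp_ofReal_mul_I θ
  refine squeeze_zero_norm (a := fun N : ℕ => 1 / ((N : ℝ) + 1) * (2 / ‖z - 1‖)) (fun N => ?_) ?_
  · rw [integral_cesaroMeasure]
    have h1 : ∑ n ∈ Finset.range (N + 1), Complex.exp (Complex.I * ((n : ℤ) : ℂ) * θ) =
        (z ^ (N + 1) - 1) / (z - 1) := by
      rw [← geom_sum_eq hne]
      refine Finset.sum_congr rfl fun n _ => ?_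
      rw [hz, ← Complex.exp_nat_mul]
      congr 1
      push_cast
      ring
    rw [h1, norm_smul, norm_div, Real.norm_of_nonneg (by positivity), one_div]
    push_cast
    gcongr
    refine (norm_sub_le _ _).trans ?_
    simp [hz1]
    norm_num
  · simpa using tendsto_one_div_add_atTop_nhds_zero_nat.mul_const (2 / ‖z - 1‖)

lemma upperDensityAlong_cesaroMeasure_le (B : Set ℤ) :
    upperDensityAlong cesaroMeasure B ≤ upperBanachDensity B := by
  have h := (tendsto_upperBanachDensity B).comp (tendsto_add_atTop_nat 1)
  rw [← h.limsup_eq]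
  refine limsup_le_limsup (Eventually.of_forall fun N => ?_)
    (isCoboundedUnder_le_of_le atTop (x := 0) fun N => measureReal_nonneg) h.isBoundedUnder_le
  simp only [cesaroMeasure_real_apply, Function.comp_apply]
  gcongr
  exact ncard_window_le_max B 0 (N + 1)

/-- **Mean ergodic theorem** along equidistributed averaging sequences, for vectors orthogonal to
all fixed vectors. The limit of the norms does not depend on the sequence, and it is zero for the
Cesàro averages by von Neumann's theorem. -/
theorem IsEquidistributedAveraging.tendsto_integral_zpow_apply {H : Type*} [NormedAddCommGroup H]
    [InnerProductSpace ℂ H] [CompleteSpace H] (U : unitary (H →L[ℂ] H)) (x : H)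
    (hx : ∀ y, (U : H →L[ℂ] H) y = y → inner ℂ y x = 0)
    {ν : ℕ → ProbabilityMeasure ℤ} (hν : IsEquidistributedAveraging ν) :
    Tendsto (fun j => ∫ n : ℤ, ((U ^ n : unitary (H →L[ℂ] H)) : H →L[ℂ] H) x ∂(ν j : Measure ℤ))
      atTop (𝓝 0) := by
  obtain ⟨c, hc⟩ := exists_tendsto_norm_sq_integral_zpow U x
  have h1 := ContinuousLinearMap.tendsto_birkhoffAverage_orthogonalProjection (U : H →L[ℂ] H)
    (ContinuousLinearMap.opNorm_le_bound _ zero_le_one fun y => by simp [Unitary.norm_map]) x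
  rw [Submodule.orthogonalProjectionOnto_eq_zero_iff.mpr (by
    rw [Submodule.mem_orthogonal]
    exact fun y hy => hx y hy)] at h1
  have h2 : Tendsto (fun j => ‖∫ n : ℤ, ((U ^ n : unitary (H →L[ℂ] H)) : H →L[ℂ] H) x
      ∂(cesaroMeasure j : Measure ℤ)‖ ^ 2) atTop (𝓝 0) := by
    have h3 := ((h1.comp (tendsto_add_atTop_nat 1)).norm).pow 2
    simp only [ZeroMemClass.coe_zero, norm_zero, ne_eq, OfNat.ofNat_ne_zero, not_false_eq_true,
      zero_pow] at h3
    refine h3.congr fun N => ?_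
    rw [integral_cesaroMeasure]
    simp only [Function.comp_apply, birkhoffAverage, birkhoffSum, id]
    congr 2
    rw [← Complex.coe_smul]
    congr 1
    · push_cast; rfl
    · refine Finset.sum_congr rfl fun n _ => ?_
      rw [zpow_natCast, SubmonoidClass.coe_pow, FunLike.coe_pow_eq_iterate]
  have h4 := hc ν hν
  rw [tendsto_nhds_unique (hc _ isEquidistributedAveraging_cesaroMeasure) h2] at h4
  rw [tendsto_zero_iff_norm_tendsto_zero]
  simpa using h4.sqrt

/-! ### Kronecker systems -/

section Kronecker

variable {Z : Type*} [AddCommGroup Z] [TopologicalSpace Z] [IsTopologicalAddGroup Z]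
  [MeasurableSpace Z] [BorelSpace Z]

/-- A compact group acts ergodically on itself by translations: if `s` is invariant modulo null
sets, then the restriction of the Haar measure to `s` is invariant, hence a multiple of the Haar
measure. This argument needs no measurability of addition on the product, which may fail when the
group is not second countable. -/
lemma ergodicVAdd_self [CompactSpace Z] (m : Measure Z) [m.IsAddHaarMeasure] :
    ErgodicVAdd Z Z m where
  measure_preimage_vadd c s hs := by simp
  aeconst_of_forall_preimage_vadd_ae_eq {s} hs h := by
    have hinv : (m.restrict s).IsAddLeftInvariant := ⟨fun g => by
      ext t ht
      have hg : Measurable (g + ·) := (continuous_const_add g).measurable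
      rw [Measure.map_apply hg ht, Measure.restrict_apply ht, Measure.restrict_apply (hg ht),
        ← measure_preimage_add m g (t ∩ s), Set.preimage_inter]
      exact measure_congr ((ae_eq_refl _).inter (h g).symm)⟩
    have key := Measure.isAddInvariant_eq_smul_of_compactSpace (m.restrict s) m
    have h1 : (m.restrict s) sᶜ = 0 := by simp [Measure.restrict_apply hs.compl]
    rw [eventuallyConst_set']
    rw [key, Measure.smul_apply, ENNReal.smul_def, smul_eq_mul, mul_eq_zero] at h1
    rcases h1 with h1 | h1
    · left
      rw [ENNReal.coe_eq_zero] at h1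
      rw [h1, zero_smul, Measure.restrict_eq_zero] at key
      exact ae_eq_empty.mpr key
    · right
      exact ae_eq_univ.mpr h1

lemma IsKroneckerSystem.ergodic [CompactSpace Z] [T2Space Z] {m : Measure Z} {α : Z}
    (h : IsKroneckerSystem m α) : Ergodic (· + α) m := by
  have := h.isAddHaarMeasure
  have := h.regular
  have := h.isProbabilityMeasure
  have := ergodicVAdd_self m
  have h1 := ergodic_vadd_of_denseRange_zsmul (g := α) h.dense m
  simpa [vadd_eq_add, add_comm] using h1

variable (m : Measure Z) [m.IsAddLeftInvariant]

lemma measurePreserving_add_const (c : Z) : MeasurePreserving (· + c) m m := by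
  simpa [add_comm] using (⟨(continuous_const_add c).measurable, map_add_left_eq_self m c⟩ :
    MeasurePreserving (c + ·) m m)

/-- The Koopman operator `f ↦ f(· + α)` on `L²`, as a unitary operator. -/
noncomputable def koopman (α : Z) : unitary (Lp ℂ 2 m →L[ℂ] Lp ℂ 2 m) :=
  Unitary.linearIsometryEquiv.symm <| LinearIsometryEquiv.ofSurjective
    (Lp.compMeasurePreservingₗᵢ ℂ (· + α) (measurePreserving_add_const m α)) fun f => by
      refine ⟨Lp.compMeasurePreserving (· + -α) (measurePreserving_add_const m (-α)) f, ?_⟩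
      rw [← Lp.toLp_coeFn f (Lp.memLp f), Lp.toLp_compMeasurePreserving]
      change Lp.compMeasurePreserving _ _ _ = _
      rw [Lp.toLp_compMeasurePreserving]
      congr 1
      ext z
      simp

lemma koopman_apply (α : Z) (f : Lp ℂ 2 m) : (koopman m α : Lp ℂ 2 m →L[ℂ] Lp ℂ 2 m) f =
    Lp.compMeasurePreserving (· + α) (measurePreserving_add_const m α) f := rfl

lemma koopman_zpow_toLp (α : Z) (n : ℤ) {g : Z → ℂ} (hg : MemLp g 2 m) :
    ((koopman m α ^ n : unitary (Lp ℂ 2 m →L[ℂ] Lp ℂ 2 m)) : Lp ℂ 2 m →L[ℂ] Lp ℂ 2 m)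
        (hg.toLp g) =
      (hg.comp_measurePreserving (measurePreserving_add_const m (n • α))).toLp _ := by
  induction n generalizing g with
  | zero =>
    simp only [zpow_zero, OneMemClass.coe_one, one_apply_eq_self]
    congr 1
    ext z
    simp
  | succ k ih =>
    rw [zpow_add_one, Submonoid.coe_mul, mul_apply_eq_comp, koopman_apply,
      Lp.toLp_compMeasurePreserving, ih]
    congr 1
    ext z
    simp [add_smul, add_assoc]
  | pred k ih =>
    have h1 : hg.toLp g = (koopman m α : Lp ℂ 2 m →L[ℂ] Lp ℂ 2 m)
        ((hg.comp_measurePreserving (measurePreserving_add_const m (-α))).toLp _) := by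
      rw [koopman_apply, Lp.toLp_compMeasurePreserving]
      congr 1
      ext z
      simp
    rw [h1, ← mul_apply_eq_comp, ← Submonoid.coe_mul, zpow_sub_one, inv_mul_cancel_right, ih]
    congr 1
    ext z
    simp [sub_eq_add_neg, add_smul, add_assoc]

/-- The averages of the Koopman operator in `L²` are given by pointwise averages. -/
lemma coeFn_integral_koopman_zpow [IsProbabilityMeasure m] (α : Z) (μ : ProbabilityMeasure ℤ)
    {g : Z → ℂ} (hg : MemLp g 2 m) (hgm : Measurable g) {K : ℝ} (hK : ∀ z, ‖g z‖ ≤ K) :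
    (∫ n : ℤ, ((koopman m α ^ n : unitary (Lp ℂ 2 m →L[ℂ] Lp ℂ 2 m)) : Lp ℂ 2 m →L[ℂ] Lp ℂ 2 m)
      (hg.toLp g) ∂(μ : Measure ℤ) : Lp ℂ 2 m) =ᵐ[m]
      fun z => ∫ n : ℤ, g (z + n • α) ∂(μ : Measure ℤ) := by
  have hm : Measurable (Function.uncurry fun (n : ℤ) (z : Z) => g (z + n • α)) :=
    measurable_from_prod_countable_right fun n => by
      exact hgm.comp (continuous_add_const (n • α)).measurable
  have hint (ρ : Measure Z) [IsFiniteMeasure ρ] :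
      Integrable (Function.uncurry fun (n : ℤ) (z : Z) => g (z + n • α)) ((μ : Measure ℤ).prod ρ) :=
    Integrable.of_bound hm.aestronglyMeasurable K (ae_of_all _ fun p => hK _)
  refine Integrable.ae_eq_of_forall_setIntegral_eq _ _ ((Lp.memLp _).integrable (by norm_num))
    (hint m).integral_prod_right fun s hs hms => ?_
  have hms' : m s ≠ ⊤ := hms.ne
  rw [← L2.inner_indicatorConstLp_one hs hms', ← innerSL_apply_apply ℂ,
    ← ContinuousLinearMap.integral_comp_comm, ← integral_integral_swap (hint (m.restrict s))]
  · refine integral_congr_ae (ae_of_all _ fun n => ?_)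
    simp only [innerSL_apply_apply]
    rw [L2.inner_indicatorConstLp_one, koopman_zpow_toLp]
    exact integral_congr_ae (ae_restrict_of_ae (MemLp.coeFn_toLp _))
  · exact integrable_of_norm_le (C := ‖hg.toLp g‖) _ fun n => by rw [Unitary.norm_map]

end Kronecker

/-! ### Sums with sets of return times -/

section Returns

variable {Z : Type*} [AddCommGroup Z] [TopologicalSpace Z] [IsTopologicalAddGroup Z]
  [CompactSpace Z] [T2Space Z] [MeasurableSpace Z] [BorelSpace Z] {m : Measure Z} {α : Z}

/-- Visits to a measurable set `C` along an equidistributed averaging sequence: the mean ergodic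
theorem gives convergence in `L²`, hence almost everywhere along a subsequence. -/
theorem IsKroneckerSystem.exists_seq_tendsto_ae (h : IsKroneckerSystem m α) {C : Set Z}
    (hC : MeasurableSet C) {ν : ℕ → ProbabilityMeasure ℤ} (hν : IsEquidistributedAveraging ν) :
    ∃ ns : ℕ → ℕ, StrictMono ns ∧ ∀ᵐ z ∂m,
      Tendsto (fun k => (ν (ns k) : Measure ℤ).real {n | z + n • α ∈ C}) atTop (𝓝 (m.real C)) := by
  have := h.isAddHaarMeasure
  have := h.isProbabilityMeasure
  -- The centred indicator function of `C` is orthogonal to the invariant functions.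
  let g : Z → ℂ := fun z => C.indicator (fun _ => 1) z - m.real C
  have hgm : Measurable g := (measurable_const.indicator hC).sub_const _
  have hgK (z : Z) : ‖g z‖ ≤ 1 + ‖(m.real C : ℂ)‖ :=
    (norm_sub_le _ _).trans (add_le_add_left (by
      by_cases hz : z ∈ C <;> simp [hz]) _)
  have hg : MemLp g 2 m := MemLp.of_bound hgm.aestronglyMeasurable _ (ae_of_all _ hgK)
  have hfix (y : Lp ℂ 2 m) (hy : (koopman m α : Lp ℂ 2 m →L[ℂ] Lp ℂ 2 m) y = y) :
      inner ℂ y (hg.toLp g) = 0 := by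
    rw [koopman_apply] at hy
    have h1 := Lp.coeFn_compMeasurePreserving y (measurePreserving_add_const m α)
    rw [hy] at h1
    obtain ⟨c, hc⟩ := h.ergodic.ae_eq_const_of_ae_eq_comp_ae (Lp.aestronglyMeasurable y) h1.symm
    have h2 : ∫ z, g z ∂m = 0 := by
      simp only [g]
      rw [integral_sub (f := C.indicator fun _ => 1) ((integrable_const (1 : ℂ)).indicator hC)
        (integrable_const _)]
      have := integral_indicator_const (μ := m) (1 : ℂ) hC
      simpa [sub_eq_zero] using this
    rw [L2.inner_def]
    calc ∫ z, inner ℂ (y z) (hg.toLp g z) ∂m = ∫ z, g z * (starRingEnd ℂ) c ∂m := by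
          refine integral_congr_ae ?_
          filter_upwards [hc, hg.coeFn_toLp] with z hz1 hz2
          rw [hz1, hz2]
          rfl
      _ = 0 := by rw [integral_mul_const, h2, zero_mul]
  have hlim := hν.tendsto_integral_zpow_apply (koopman m α) (hg.toLp g) hfix
  obtain ⟨ns, hns, hae⟩ := (tendstoInMeasure_of_tendsto_Lp hlim).exists_seq_tendsto_ae
  refine ⟨ns, hns, ?_⟩
  have hall : ∀ᵐ z ∂m, ∀ j, _ := ae_all_iff.mpr fun j =>
    coeFn_integral_koopman_zpow m α (ν j) hg hgm hgK
  filter_upwards [hae, hall, Lp.coeFn_zero ℂ 2 m] with z hz1 hz2 hz3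
  rw [hz3] at hz1
  have hre := ((Complex.continuous_re.tendsto _).comp hz1).add_const (m.real C)
  simp only [Pi.zero_apply, Complex.zero_re, zero_add] at hre
  refine hre.congr fun k => ?_
  refine (congrArg (fun w : ℂ => w.re + m.real C) (hz2 (ns k))).trans ?_
  have h3 : ∫ n : ℤ, g (z + n • α) ∂(ν (ns k) : Measure ℤ) =
      ((ν (ns k) : Measure ℤ).real {n | z + n • α ∈ C} : ℂ) - m.real C := by
    have h4 : (fun n : ℤ => g (z + n • α)) =
        fun n : ℤ => {n : ℤ | z + n • α ∈ C}.indicator (fun _ => (1 : ℂ)) n - m.real C := rfl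
    rw [h4, integral_sub (f := Set.indicator _ fun _ => 1)
      ((integrable_const (1 : ℂ)).indicator MeasurableSet.of_discrete) (integrable_const _)]
    simp
  rw [h3]
  simp

/-- The set of return times to a closed set `W` with dense complement has no piecewise syndetic
subset: finitely many translates of `W` together miss a nonempty open set, and by minimality every
orbit visits that open set with bounded gaps. -/
theorem IsKroneckerSystem.not_isPiecewiseSyndetic (h : IsKroneckerSystem m α) {W : Set Z}
    (hW : IsClosed W) (hd : Dense Wᶜ) (z : Z) {S : Set ℤ} (hS : ∀ n ∈ S, z + n • α ∈ W) :
    ¬ IsPiecewiseSyndetic S := by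
  intro hps
  obtain ⟨F, hF, hthick⟩ := hps.exists_finite_isThick_add
  let O : Set Z := ⋂ f ∈ F, (· + -(f • α)) ⁻¹' Wᶜ
  have hO : IsOpen O := hF.isOpen_biInter fun f _ =>
    hW.isOpen_compl.preimage (continuous_add_const _)
  have hOd : Dense O := dense_biInter_of_isOpen
    (fun f _ => hW.isOpen_compl.preimage (continuous_add_const _)) hF.countable
    fun f _ => hd.preimage (isOpenMap_add_right _)
  obtain ⟨o, ho⟩ := hOd.nonempty
  -- By compactness, finitely many translates of `O` along the orbit cover the group.
  have hcover : (Set.univ : Set Z) ⊆ ⋃ n : ℤ, (· + n • α) ⁻¹' O := fun w _ => by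
    obtain ⟨x, hx, n, rfl⟩ := h.dense.inter_open_nonempty _ (hO.preimage (continuous_const_add w))
      ⟨-w + o, by simpa using ho⟩
    exact Set.mem_iUnion.mpr ⟨n, hx⟩
  obtain ⟨t, ht⟩ := isCompact_univ.elim_finite_subcover _
    (fun n => hO.preimage (continuous_add_const _)) hcover
  obtain ⟨L, hL⟩ : ∃ L : ℕ, ∀ n ∈ t, n.natAbs ≤ L := ⟨t.sup Int.natAbs, fun n hn => t.le_sup hn⟩
  obtain ⟨N, hN⟩ := hthick (2 * L + 1)
  obtain ⟨n, hn, hmem⟩ : ∃ n ∈ t, z + (N + L) • α + n • α ∈ O := by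
    simpa using ht (Set.mem_univ (z + (N + L : ℤ) • α))
  have := hL n hn
  obtain ⟨s, hs, f, hf, hsf⟩ : N + L + n ∈ S + F := hN (by
    simp only [Set.mem_Ico]
    push_cast
    constructor <;> omega)
  simp only [O, Set.mem_iInter] at hmem
  refine hmem f hf ?_
  convert hS s hs using 1
  have key : (N + L : ℤ) • α + n • α = s • α + f • α := by
    rw [← add_smul, ← add_smul, ← hsf]
  rw [add_assoc z, key]
  change z + (s • α + f • α) + -(f • α) = z + s • α
  abel

/-- For a null set `K` there is a closed set `C` of measure close to `1` such that `K + C` has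
dense complement. It is obtained by removing from the group small neighbourhoods of the null sets
`n • α - K`, so that `K + C` misses the dense orbit of `0`. -/
theorem IsKroneckerSystem.exists_isClosed_dense_compl_add (h : IsKroneckerSystem m α) {K : Set Z}
    (hK0 : m K = 0) {ε : ℝ} (hε : 0 < ε) :
    ∃ C : Set Z, IsClosed C ∧ 1 - ε < m.real C ∧ Dense (K + C)ᶜ := by
  have := h.isAddHaarMeasure
  have := h.isProbabilityMeasure
  have := h.regular
  obtain ⟨δ, hδ, hsum⟩ :=
    ENNReal.exists_pos_sum_of_countable' (ENNReal.ofReal_pos.mpr hε).ne' ℤ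
  have hnull (n : ℤ) : m ((n • α - ·) ⁻¹' K) = 0 := by
    have : (n • α - ·) ⁻¹' K = Neg.neg ⁻¹' ((n • α + ·) ⁻¹' K) := by
      ext z
      simp [sub_eq_add_neg]
    rw [this, Measure.measure_preimage_neg, measure_preimage_add, hK0]
  choose U hKU hU hUδ using fun n : ℤ =>
    Set.exists_isOpen_lt_of_lt ((n • α - ·) ⁻¹' K) (δ n) ((hnull n).trans_lt (hδ n))
  have hUo : IsOpen (⋃ n, U n) := isOpen_iUnion hU
  refine ⟨(⋃ n, U n)ᶜ, hUo.isClosed_compl, ?_, h.dense.mono ?_⟩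
  · have hlt : m (⋃ n, U n) < ENNReal.ofReal ε :=
      ((measure_iUnion_le U).trans (ENNReal.tsum_le_tsum fun n => (hUδ n).le)).trans_lt hsum
    have : m.real (⋃ n, U n) < ε := by
      rw [measureReal_def, ← ENNReal.toReal_ofReal hε.le]
      exact (ENNReal.toReal_lt_toReal (by finiteness) (by finiteness)).mpr hlt
    rw [probReal_compl_eq_one_sub hUo.measurableSet]
    linarith
  · rintro _ ⟨n, rfl⟩ ⟨k, hk, c, hc, hkc⟩
    refine hc (Set.mem_iUnion.mpr ⟨n, hKU n ?_⟩)
    have hkc : k + c = n • α := hkc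
    simpa [← hkc] using hk

/-- One set `B` serves countably many equidistributed averaging sequences at once. -/
theorem IsKroneckerSystem.exists_upperDensityAlong (h : IsKroneckerSystem m α) {A : Set ℤ}
    (hA : m (closure ((fun n : ℤ => n • α) '' A)) = 0) (ν : ℕ → ℕ → ProbabilityMeasure ℤ)
    (hν : ∀ i, IsEquidistributedAveraging (ν i)) {ε : ℝ} (hε : 0 < ε) :
    ∃ B : Set ℤ, (∀ i, 1 - ε < upperDensityAlong (ν i) B) ∧ ¬ IsPiecewiseSyndetic (A + B) := by
  have := h.isProbabilityMeasure
  obtain ⟨C, hC, hCε, hd⟩ := h.exists_isClosed_dense_compl_add hA hε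
  choose ns hns hae using fun i => h.exists_seq_tendsto_ae hC.measurableSet (hν i)
  obtain ⟨z, hz⟩ := (ae_all_iff.mpr hae).exists
  refine ⟨{n | z + n • α ∈ C}, fun i => ?_, ?_⟩
  · obtain ⟨r, hr1, hr2⟩ := exists_between hCε
    refine hr1.trans_le (le_limsup_of_frequently_le ?_ ?_)
    · exact (hns i).tendsto_atTop.frequently
        (((hz i).eventually (lt_mem_nhds hr2)).mono fun k hk => hk.le).frequently
    · exact isBoundedUnder_of ⟨1, fun j => measureReal_le_one⟩
  · refine h.not_isPiecewiseSyndetic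
      (isClosed_closure.isCompact.add hC.isCompact).isClosed hd z ?_
    rintro _ ⟨a, ha, b, hb, rfl⟩
    refine ⟨a • α, subset_closure ⟨a, ha, rfl⟩, z + b • α, hb, ?_⟩
    simp only [add_smul]
    abel

end Returns

theorem mainTheorem6 {Z : Type*} [AddCommGroup Z] [TopologicalSpace Z] [IsTopologicalAddGroup Z]
    [CompactSpace Z] [T2Space Z] [MeasurableSpace Z] [BorelSpace Z]
    (m : Measure Z) (α : Z) (hZ : IsKroneckerSystem m α)
    (A : Set ℤ) (hA : m (closure ((fun n : ℤ => n • α) '' A)) = 0) :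
    (∀ ε : ℝ, 0 < ε →
      ∃ B : Set ℤ, 1 - ε < upperBanachDensity B ∧ ¬ IsPiecewiseSyndetic (A + B)) ∧
    (∀ ν : ℕ → ℕ → ProbabilityMeasure ℤ, (∀ i, IsEquidistributedAveraging (ν i)) →
      ∀ ε : ℝ, 0 < ε →
        ∃ B : Set ℤ, (∀ i, 1 - ε < upperDensityAlong (ν i) B) ∧
          ¬ IsPiecewiseSyndetic (A + B)) := by
  refine ⟨fun ε hε => ?_, fun ν hν ε hε => hZ.exists_upperDensityAlong hA ν hν hε⟩
  obtain ⟨B, hB, hAB⟩ := hZ.exists_upperDensityAlong hA (fun _ => cesaroMeasure)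
    (fun _ => isEquidistributedAveraging_cesaroMeasure) hε
  exact ⟨B, (hB 0).trans_le (upperDensityAlong_cesaroMeasure_le B), hAB⟩
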